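/- Let $0<\alpha<2$ and $0<|\rho_1|,|\rho_2|<1$. Let $(\boldsymbol{\varepsilon}_t)_{t\in\mathbb{Z}}$, $\boldsymbol{\varepsilon}_t=(\varepsilon_{1,t},\varepsilon_{2,t})$, be i.i.d. symmetric $\alpha$-stable (S$\alpha$S) random vectors in $\mathbb{R}^2$ with zero shift and (finite, symmetric) spectral measure $\Gamma_2$ on the Euclidean unit circle $S_2$, i.e. $\mathbb{E}\,e^{i\langle u,\boldsymbol{\varepsilon}_t\rangle}=\exp\{-\int_{S_2}|\langle u,s\rangle|^\alpha\,\Gamma_2(ds)\}$ for all $u\in\mathbb{R}^2$. Let $\boldsymbol{X}_t=(X_{1,t},X_{2,t})$, $t\in\mathbb{Z}$, be the strictly stationary process satisfying, almost surely for every $t\in\mathbb{Z}$, $$X_{1,t}=\rho_1X_{1,t+1}+\varepsilon_{1,t},\qquad X_{2,t}=\rho_2X_{2,t-1}+\varepsilon_{2,t}.$$ Let $\|\cdot\|$ be the seminorm $\|(x_1,x_2,x_3,x_4)\|=\sqrt{x_1^2+x_2^2}$ on $\mathbb{R}^4$ and $C_4^{\|\cdot\|}=\{s\in\mathbb{R}^4:\|s\|=1\}$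 its unit cylinder. Then, for every $t\in\mathbb{Z}$, the vector $\underline{\boldsymbol{X}}_t=(X_{1,t},X_{2,t},X_{1,t+1},X_{2,t+1})$ is S$\alpha$S, that is, its law is symmetric and, for independent copies $\underline{\boldsymbol{X}}^{(1)},\underline{\boldsymbol{X}}^{(2)}$ of $\underline{\boldsymbol{X}}_t$ and all $A,B>0$, $A\underline{\boldsymbol{X}}^{(1)}+B\underline{\boldsymbol{X}}^{(2)}$ has the law of $(A^\alpha+B^\alpha)^{1/\alpha}\,\underline{\boldsymbol{X}}_t+D$ for some non-random $D\in\mathbb{R}^4$. Moreover, $\underline{\boldsymbol{X}}_t$ is representable on $C_4^{\|\cdot\|}$, meaning that there is a symmetric Borel measure $\Gamma$ on $C_4^{\|\cdot\|}$ with $\int|\langle u,s\rangle|^\alpha\,\Gamma(ds)<\infty$ and $\mathbb{E}\,e^{i\langle u,\underline{\boldsymbol{X}}_t\rangle}=\exp\{-\int|\langle u,s\rangle|^\alpha\,\Gamma(ds)\}$ for all $u\in\mathbb{R}^4$, if and only if $$\Gamma_2\big(\{(0,-1),(0,+1)\}\big)=0.$$ -/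

import Mathlib

open MeasureTheory ProbabilityTheory

/-! Laws of random vectors are Borel measures on `EuclideanSpace ℝ (Fin d)`.
A measure "on" a Borel subset `S` of the space is a measure on the whole space that gives mass
zero to the complement of `S`. -/

/-- A measure on `ℝᵈ` is symmetric if it is invariant under `s ↦ -s`. -/
def IsSymmetricMeasure {d : ℕ} (ν : Measure (EuclideanSpace ℝ (Fin d))) : Prop :=
  ∀ A : Set (EuclideanSpace ℝ (Fin d)), MeasurableSet A → ν ((fun s => -s) ⁻¹' A) = ν A

/-- A probability law `ν` on `ℝᵈ` is `α`-stable if, for `X, X⁽¹⁾, X⁽²⁾` independent with law `ν`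
and for all `A, B > 0`, one has `A X⁽¹⁾ + B X⁽²⁾ = (A ^ α + B ^ α) ^ (1 / α) X + D` in law for some
non-random vector `D`. -/
def IsAlphaStable {d : ℕ} (α : ℝ) (ν : Measure (EuclideanSpace ℝ (Fin d))) : Prop :=
  IsProbabilityMeasure ν ∧
    ∀ A B : ℝ, 0 < A → 0 < B → ∃ D : EuclideanSpace ℝ (Fin d),
      (ν.prod ν).map (fun x => A • x.1 + B • x.2) =
        ν.map (fun x => ((A ^ α + B ^ α) ^ (1 / α)) • x + D)

/-- Symmetric `α`-stable (SαS) laws on `ℝᵈ`. -/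
def IsSymmetricAlphaStable {d : ℕ} (α : ℝ) (ν : Measure (EuclideanSpace ℝ (Fin d))) : Prop :=
  IsAlphaStable α ν ∧ IsSymmetricMeasure ν

/-- The law `ν` has characteristic function `u ↦ exp (- ∫ |⟨u, s⟩| ^ α Γ(ds))`, the integral being
finite for every `u`. -/
def HasSymmetricStableCharFun {d : ℕ} (α : ℝ) (ν Γ : Measure (EuclideanSpace ℝ (Fin d))) : Prop :=
  ∀ u : EuclideanSpace ℝ (Fin d),
    Integrable (fun s => |inner ℝ u s| ^ α) Γ ∧
      charFun ν u = Complex.exp (-((∫ s, |inner ℝ u s| ^ α ∂Γ : ℝ) : ℂ))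

/-- The law `ν` is SαS with zero shift vector and with the (finite, symmetric) spectral measure `Γ`
on the Euclidean unit sphere. -/
structure IsSymmetricAlphaStableWithSpectralMeasure {d : ℕ} (α : ℝ)
    (ν Γ : Measure (EuclideanSpace ℝ (Fin d))) : Prop where
  finite : IsFiniteMeasure Γ
  on_sphere : Γ (Metric.sphere (0 : EuclideanSpace ℝ (Fin d)) 1)ᶜ = 0
  symmetric : IsSymmetricMeasure Γ
  charFun_eq : HasSymmetricStableCharFun α ν Γ

/-- The unit cylinder `{s : ‖s‖ = 1}` of a seminorm on `ℝᵈ`. -/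
def unitCylinder {d : ℕ} (p : Seminorm ℝ (EuclideanSpace ℝ (Fin d))) :
    Set (EuclideanSpace ℝ (Fin d)) :=
  {s | p s = 1}

/-- Representability of an SαS law `ν` on the unit cylinder of the seminorm `p`: there is a
symmetric Borel measure on the cylinder which integrates `|⟨u, ·⟩| ^ α` for every `u` and yields
the characteristic function of `ν`. -/
def IsRepresentableOnCylinder {d : ℕ} (α : ℝ) (ν : Measure (EuclideanSpace ℝ (Fin d)))
    (p : Seminorm ℝ (EuclideanSpace ℝ (Fin d))) : Prop :=
  ∃ Γ : Measure (EuclideanSpace ℝ (Fin d)),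
    Γ (unitCylinder p)ᶜ = 0 ∧ IsSymmetricMeasure Γ ∧ HasSymmetricStableCharFun α ν Γ

/-- Strict stationarity of a process indexed by `ℤ`: its law as a process is shift invariant. -/
def IsStrictlyStationary {Ω E : Type*} [MeasurableSpace Ω] [MeasurableSpace E]
    (P : Measure Ω) (X : ℤ → Ω → E) : Prop :=
  ∀ h : ℤ, IdentDistrib (fun ω (t : ℤ) => X (t + h) ω) (fun ω (t : ℤ) => X t ω) P P

/-- `X` is the strictly stationary bivariate process whose first component is an anticipative AR(1)
and whose second component is a causal AR(1), driven by the i.i.d. SαS errors `ε` with spectral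
measure `Γ₂`. -/
structure IsBivariateStableAR1 {Ω : Type*} [MeasurableSpace Ω] (P : Measure Ω) (α ρ₁ ρ₂ : ℝ)
    (Γ₂ : Measure (EuclideanSpace ℝ (Fin 2))) (ε X : ℤ → Ω → EuclideanSpace ℝ (Fin 2)) :
    Prop where
  measurable_error : ∀ t, Measurable (ε t)
  indep_error : iIndepFun ε P
  law_error : ∀ t, IsSymmetricAlphaStableWithSpectralMeasure α (P.map (ε t)) Γ₂
  measurable : ∀ t, Measurable (X t)
  stationary : IsStrictlyStationary P X
  anticipative : ∀ t, ∀ᵐ ω ∂P, X t ω 0 = ρ₁ * X (t + 1) ω 0 + ε t ω 0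
  causal : ∀ t, ∀ᵐ ω ∂P, X t ω 1 = ρ₂ * X (t - 1) ω 1 + ε t ω 1

/-- The vector `(X_t, X_{t+1})` of `ℝ⁴`. -/
def stackedVector {Ω : Type*} (X : ℤ → Ω → EuclideanSpace ℝ (Fin 2)) (t : ℤ) (ω : Ω) :
    EuclideanSpace ℝ (Fin 4) :=
  !₂[X t ω 0, X t ω 1, X (t + 1) ω 0, X (t + 1) ω 1]

/-- The seminorm `(x₁, x₂, x₃, x₄) ↦ √(x₁² + x₂²)` on `ℝ⁴`. -/
noncomputable def presentSeminorm : Seminorm ℝ (EuclideanSpace ℝ (Fin 4)) :=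
  Seminorm.of (fun x => √(x 0 ^ 2 + x 1 ^ 2))
    (fun x y => by
      have h := norm_add_le (!₂[x 0, x 1] : EuclideanSpace ℝ (Fin 2)) !₂[y 0, y 1]
      simpa [EuclideanSpace.norm_eq, Fin.sum_univ_two] using h)
    (fun a x => by
      have h := norm_smul a (!₂[x 0, x 1] : EuclideanSpace ℝ (Fin 2))
      simpa [EuclideanSpace.norm_eq, Fin.sum_univ_two, mul_pow, sq_abs] using h)

open Filter Topology

/-! Iterating the two recursions exhibits the stacked vector as the limit in law of the independent
sums `∑ j, T j (ε (t + j))`, where `T j = arFilter ρ₁ ρ₂ j`. Its characteristic function is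
therefore that of an SαS law with spectral measure `Λ = ∑ j, (T j)_* Γ₂` on `ℝ⁴`.

Such a `Λ` is not unique, but whether it charges `N \ {0}` for a subspace `N` can be read off the
characteristic function: if `w n ⟂ N` and `|⟨w n, s⟩| → ∞` for every `s ∉ N`, then the second
differences with step `e` of `u ↦ ∫ |⟨u, s⟩| ^ α Λ(ds)` at `w n` tend to
`2 ∫ s in N, |⟨e, s⟩| ^ α Λ(ds)`, because `α < 2`. A measure on the unit cylinder of a seminorm does
not charge the kernel `N` of the seminorm, so representability forces `Λ (N \ {0}) = 0`; conversely,
if `Λ (N \ {0}) = 0`, then `Λ` can be projected radially onto the cylinder.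

Finally, `T j s` lies in `N \ {0}` only for `j = 1` and `s ≠ 0` on the second axis: the error
`ε₂` at time `t + 1` enters `X₂` at time `t + 1` but none of the present components.
-/

section AbsRpow

variable {α : ℝ}

/-- The second difference with step `h` of `x ↦ |x| ^ α` at `x`. For `0 < α < 2` it equals
`2 |h| ^ α` at `x = 0` and vanishes as `|x| → ∞`, so it detects the zeros of a diverging family. -/
noncomputable def absRpowSecondDiff (α x h : ℝ) : ℝ :=
  |x + h| ^ α + |x - h| ^ α - 2 * |x| ^ α

lemma absRpowSecondDiff_zero_left (hα : α ≠ 0) (h : ℝ) :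
    absRpowSecondDiff α 0 h = 2 * |h| ^ α := by
  simp [absRpowSecondDiff, Real.zero_rpow hα, two_mul]

lemma abs_rpow_eq_sq_rpow (x : ℝ) : |x| ^ α = (x ^ 2) ^ (α / 2) := by
  rw [← sq_abs, ← Real.rpow_natCast_mul (abs_nonneg x)]
  congr 1
  push_cast
  ring

lemma absRpowSecondDiff_le_sq_add_sq (hα₀ : 0 ≤ α) (hα₂ : α ≤ 2) (x h : ℝ) :
    absRpowSecondDiff α x h ≤ 2 * ((x ^ 2 + h ^ 2) ^ (α / 2) - (x ^ 2) ^ (α / 2)) := by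
  have hconcave := (Real.concaveOn_rpow (p := α / 2) (by linarith) (by linarith)).2
    (Set.mem_Ici.2 (sq_nonneg (x + h))) (Set.mem_Ici.2 (sq_nonneg (x - h)))
    (show (0 : ℝ) ≤ 1 / 2 by norm_num) (show (0 : ℝ) ≤ 1 / 2 by norm_num) (by norm_num)
  simp only [smul_eq_mul] at hconcave
  rw [show 1 / 2 * (x + h) ^ 2 + 1 / 2 * (x - h) ^ 2 = x ^ 2 + h ^ 2 by ring] at hconcave
  simp only [absRpowSecondDiff, abs_rpow_eq_sq_rpow]
  linarith

lemma abs_sq_sub_sq_le_absRpowSecondDiff (x h : ℝ) :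
    2 * (|x ^ 2 - h ^ 2| ^ (α / 2) - (x ^ 2) ^ (α / 2)) ≤ absRpowSecondDiff α x h := by
  have hprod : |x ^ 2 - h ^ 2| ^ (α / 2) = |x + h| ^ (α / 2) * |x - h| ^ (α / 2) := by
    rw [← Real.mul_rpow (abs_nonneg _) (abs_nonneg _), ← abs_mul]
    ring_nf
  have hsq : ∀ y : ℝ, |y| ^ α = (|y| ^ (α / 2)) ^ 2 := fun y => by
    rw [← Real.rpow_mul_natCast (abs_nonneg y)]
    congr 1
    push_cast
    ring
  have hamgm := two_mul_le_add_sq (|x + h| ^ (α / 2)) (|x - h| ^ (α / 2))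
  rw [← hsq, ← hsq] at hamgm
  rw [absRpowSecondDiff, ← abs_rpow_eq_sq_rpow, hprod]
  linarith

lemma abs_absRpowSecondDiff_le (hα₀ : 0 ≤ α) (hα₂ : α ≤ 2) (x h : ℝ) :
    |absRpowSecondDiff α x h| ≤ 2 * |h| ^ α := by
  have hupper := absRpowSecondDiff_le_sq_add_sq hα₀ hα₂ x h
  have hlower := abs_sq_sub_sq_le_absRpowSecondDiff (α := α) x h
  have hadd : (x ^ 2 + h ^ 2) ^ (α / 2) ≤ (x ^ 2) ^ (α / 2) + (h ^ 2) ^ (α / 2) :=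
    Real.rpow_add_le_add_rpow (sq_nonneg x) (sq_nonneg h) (by linarith) (by linarith)
  have hsub : (x ^ 2) ^ (α / 2) ≤ |x ^ 2 - h ^ 2| ^ (α / 2) + (h ^ 2) ^ (α / 2) :=
    calc (x ^ 2) ^ (α / 2) ≤ (|x ^ 2 - h ^ 2| + h ^ 2) ^ (α / 2) :=
          Real.rpow_le_rpow (sq_nonneg x) (by linarith [le_abs_self (x ^ 2 - h ^ 2)])
            (by linarith)
      _ ≤ _ := Real.rpow_add_le_add_rpow (abs_nonneg _) (sq_nonneg h) (by linarith) (by linarith)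
  rw [abs_rpow_eq_sq_rpow h, abs_le]
  constructor <;> linarith

lemma tendsto_add_rpow_sub_rpow_atTop {β c : ℝ} (hβ₀ : 0 ≤ β) (hβ₁ : β < 1) (hc : 0 ≤ c) :
    Tendsto (fun y : ℝ => (y + c) ^ β - y ^ β) atTop (𝓝 0) := by
  have hbound : Tendsto (fun y : ℝ => β * c * y ^ (-(1 - β))) atTop (𝓝 0) := by
    simpa using (tendsto_rpow_neg_atTop (sub_pos.2 hβ₁)).const_mul (β * c)
  refine squeeze_zero' ?_ ?_ hbound
  · filter_upwards [eventually_ge_atTop 0] with y hy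
    exact sub_nonneg.2 (Real.rpow_le_rpow hy (by linarith) hβ₀)
  · filter_upwards [eventually_gt_atTop 0] with y hy
    have hbernoulli : (1 + c / y) ^ β ≤ 1 + β * (c / y) :=
      rpow_one_add_le_one_add_mul_self (by linarith [div_nonneg hc hy.le]) hβ₀ hβ₁.le
    rw [show y + c = y * (1 + c / y) by field_simp, Real.mul_rpow hy.le (by positivity),
      neg_sub, Real.rpow_sub_one hy.ne', sub_le_iff_le_add]
    exact (mul_le_mul_of_nonneg_left hbernoulli (Real.rpow_nonneg hy.le β)).trans_eq (by ring)

lemma tendsto_absRpowSecondDiff_cobounded (hα₀ : 0 ≤ α) (hα₂ : α < 2) (h : ℝ) :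
    Tendsto (fun x => absRpowSecondDiff α x h) (Bornology.cobounded ℝ) (𝓝 0) := by
  have hsq : Tendsto (fun x : ℝ => x ^ 2) (Bornology.cobounded ℝ) atTop :=
    ((tendsto_pow_atTop two_ne_zero).comp tendsto_norm_cobounded_atTop).congr sq_abs
  have hincrement := (tendsto_add_rpow_sub_rpow_atTop (β := α / 2) (by linarith) (by linarith)
    (sq_nonneg h)).const_mul 2
  rw [mul_zero] at hincrement
  have hsq_sub := tendsto_atTop_add_const_right _ (-h ^ 2) hsq
  have hlower := (hincrement.comp hsq_sub).neg
  rw [neg_zero] at hlower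
  refine tendsto_of_tendsto_of_tendsto_of_le_of_le' hlower (hincrement.comp hsq) ?_
    (Eventually.of_forall fun x => absRpowSecondDiff_le_sq_add_sq hα₀ hα₂.le x h)
  filter_upwards [hsq_sub.eventually_ge_atTop 0] with x hx
  have hdiff := abs_sq_sub_sq_le_absRpowSecondDiff (α := α) x h
  rw [abs_of_nonneg (by linarith)] at hdiff
  simp only [Function.comp_apply, ← sub_eq_add_neg, sub_add_cancel]
  linarith

end AbsRpow

section InnerProductSpace

variable {E : Type*} [NormedAddCommGroup E] [InnerProductSpace ℝ E]

lemma exists_seq_inner_eq_zero_and_tendsto_cobounded [FiniteDimensional ℝ E]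
    (N : Submodule ℝ E) :
    ∃ w : ℕ → E, (∀ s ∈ N, ∀ n, inner ℝ (w n) s = 0) ∧
      ∀ s ∉ N, Tendsto (fun n => inner ℝ (w n) s) atTop (Bornology.cobounded ℝ) := by
  -- A moment curve in `Nᗮ`: along it `⟪·, s⟫` is a polynomial in `n` without constant term, whose
  -- coefficients are the coordinates of the projection of `s`.
  let b := stdOrthonormalBasis ℝ Nᗮ
  refine ⟨fun n => ∑ j : Fin _, (n : ℝ) ^ ((j : ℕ) + 1) • (b j : E), fun s hs n => ?_,
    fun s hs => ?_⟩
  · have horth : ∀ j, inner ℝ (b j : E) s = 0 := fun j =>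
      N.inner_left_of_mem_orthogonal hs (b j).2
    simp [sum_inner, real_inner_smul_left, horth]
  · let P : Polynomial ℝ := ∑ j : Fin _, Polynomial.monomial ((j : ℕ) + 1) (inner ℝ (b j : E) s)
    have hcoeff : ∀ k : Fin _, P.coeff ((k : ℕ) + 1) = inner ℝ (b k : E) s := fun k => by
      simp [P, Polynomial.finsetSum_coeff, Polynomial.coeff_monomial, Fin.val_inj]
    obtain ⟨k, hk⟩ : ∃ k, inner ℝ (b k : E) s ≠ 0 := by
      by_contra! hzero
      have hinner : (innerₗ E s).domRestrict Nᗮ = 0 :=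
        b.toBasis.ext fun k => by simpa [real_inner_comm] using hzero k
      refine hs (N.orthogonal_orthogonal ▸ fun u hu => ?_)
      simpa [real_inner_comm] using LinearMap.congr_fun hinner ⟨u, hu⟩
    have hdeg : 0 < P.degree :=
      (Nat.cast_pos.2 (Nat.succ_pos k)).trans_le
        (Polynomial.le_degree_of_ne_zero (by rwa [hcoeff]))
    have heval : ∀ n : ℕ, inner ℝ (∑ j : Fin _, (n : ℝ) ^ ((j : ℕ) + 1) • (b j : E)) s =
        P.eval (n : ℝ) := fun n => by
      simp [P, sum_inner, real_inner_smul_left, Polynomial.eval_finsetSum, mul_comm]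
    simp only [heval, ← tendsto_norm_atTop_iff_cobounded]
    exact (P.abs_tendsto_atTop hdeg).comp tendsto_natCast_atTop_atTop

variable [MeasurableSpace E] {α : ℝ} {μ ν : Measure E}

lemma integral_absRpowSecondDiff_inner
    (hμ : ∀ u : E, Integrable (fun s => |inner ℝ u s| ^ α) μ) (w e : E) :
    ∫ s, absRpowSecondDiff α (inner ℝ w s) (inner ℝ e s) ∂μ =
      ∫ s, |inner ℝ (w + e) s| ^ α ∂μ + ∫ s, |inner ℝ (w - e) s| ^ α ∂μ -
        2 * ∫ s, |inner ℝ w s| ^ α ∂μ := by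
  rw [← integral_const_mul, ← integral_add (hμ _) (hμ _),
    ← integral_sub ((hμ _).fun_add (hμ _)) ((hμ _).const_mul 2)]
  simp only [absRpowSecondDiff, inner_add_left, inner_sub_left]

variable [BorelSpace E]

lemma tendsto_integral_absRpowSecondDiff_inner [SecondCountableTopology E] (hα₀ : 0 < α)
    (hα₂ : α < 2) {N : Set E} (hN : MeasurableSet N) {w : ℕ → E}
    (hw : ∀ s ∈ N, ∀ n, inner ℝ (w n) s = 0)
    (hw' : ∀ s ∉ N, Tendsto (fun n => inner ℝ (w n) s) atTop (Bornology.cobounded ℝ))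
    {e : E} (he : Integrable (fun s => |inner ℝ e s| ^ α) μ) :
    Tendsto (fun n => ∫ s, absRpowSecondDiff α (inner ℝ (w n) s) (inner ℝ e s) ∂μ) atTop
      (𝓝 (2 * ∫ s in N, |inner ℝ e s| ^ α ∂μ)) := by
  rw [← integral_const_mul, ← integral_indicator hN]
  refine tendsto_integral_of_dominated_convergence (fun s => 2 * |inner ℝ e s| ^ α)
    (fun n => Measurable.aestronglyMeasurable ?_) (he.const_mul 2)
    (fun n => ae_of_all _ fun s => abs_absRpowSecondDiff_le hα₀.le hα₂.le _ _)
    (ae_of_all _ fun s => ?_)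
  · unfold absRpowSecondDiff
    fun_prop
  · by_cases hs : s ∈ N
    · simp only [Set.indicator_of_mem hs, hw s hs, absRpowSecondDiff_zero_left hα₀.ne',
        tendsto_const_nhds]
    · rw [Set.indicator_of_notMem hs]
      exact (tendsto_absRpowSecondDiff_cobounded hα₀.le hα₂ _).comp (hw' s hs)

variable [FiniteDimensional ℝ E]

theorem setIntegral_abs_inner_rpow_eq_of_forall_integral_eq (hα₀ : 0 < α) (hα₂ : α < 2)
    (hμ : ∀ u : E, Integrable (fun s => |inner ℝ u s| ^ α) μ)
    (hν : ∀ u : E, Integrable (fun s => |inner ℝ u s| ^ α) ν)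
    (hμν : ∀ u : E, ∫ s, |inner ℝ u s| ^ α ∂μ = ∫ s, |inner ℝ u s| ^ α ∂ν)
    (N : Submodule ℝ E) (e : E) :
    ∫ s in N, |inner ℝ e s| ^ α ∂μ = ∫ s in N, |inner ℝ e s| ^ α ∂ν := by
  obtain ⟨w, hw, hw'⟩ := exists_seq_inner_eq_zero_and_tendsto_cobounded N
  have hN : MeasurableSet (N : Set E) := N.closed_of_finiteDimensional.measurableSet
  have hlimμ := tendsto_integral_absRpowSecondDiff_inner hα₀ hα₂ hN hw hw' (hμ e)
  have hlimν := tendsto_integral_absRpowSecondDiff_inner hα₀ hα₂ hN hw hw' (hν e)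
  simp only [integral_absRpowSecondDiff_inner hμ, integral_absRpowSecondDiff_inner hν, hμν]
    at hlimμ hlimν
  exact mul_left_cancel₀ two_ne_zero (tendsto_nhds_unique hlimμ hlimν)

theorem measure_submodule_diff_zero_eq_zero_of_forall_integral_eq (hα₀ : 0 < α) (hα₂ : α < 2)
    (hμ : ∀ u : E, Integrable (fun s => |inner ℝ u s| ^ α) μ)
    (hν : ∀ u : E, Integrable (fun s => |inner ℝ u s| ^ α) ν)
    (hμν : ∀ u : E, ∫ s, |inner ℝ u s| ^ α ∂μ = ∫ s, |inner ℝ u s| ^ α ∂ν)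
    (N : Submodule ℝ E) (hN : ν (N \ {0}) = 0) : μ (N \ {0}) = 0 := by
  have hmeas : MeasurableSet (N : Set E) := N.closed_of_finiteDimensional.measurableSet
  have horth : ∀ e : E, ∀ᵐ s ∂μ.restrict N, inner ℝ e s = 0 := by
    intro e
    have hzero : ∫ s in N, |inner ℝ e s| ^ α ∂μ = 0 := by
      rw [setIntegral_abs_inner_rpow_eq_of_forall_integral_eq hα₀ hα₂ hμ hν hμν N e]
      refine integral_eq_zero_of_ae ((ae_restrict_iff' hmeas).2 ?_)
      filter_upwards [measure_eq_zero_iff_ae_notMem.1 hN] with s hs hsN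
      have hs0 : s = 0 := by_contra fun h => hs ⟨hsN, h⟩
      simp [hs0, hα₀.ne']
    rw [integral_eq_zero_iff_of_nonneg (fun s => by positivity) (hμ e).integrableOn] at hzero
    filter_upwards [hzero] with s hs
    exact abs_eq_zero.1 ((Real.rpow_eq_zero (abs_nonneg _) hα₀.ne').1 hs)
  have hall := (ae_restrict_iff' hmeas).1
    (ae_all_iff.2 fun i => horth (stdOrthonormalBasis ℝ E i))
  refine measure_eq_zero_iff_ae_notMem.2 ?_
  filter_upwards [hall] with s hs hsN
  exact hsN.2 (InnerProductSpace.ext_inner_left_basis (stdOrthonormalBasis ℝ E).toBasis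
    fun i => by simpa using hs hsN.1 i)

end InnerProductSpace

section SymmetricMeasure

variable {d d' : ℕ} {ν : Measure (EuclideanSpace ℝ (Fin d))}

lemma isSymmetricMeasure_iff_map_neg_eq :
    IsSymmetricMeasure ν ↔ ν.map (fun s => -s) = ν := by
  refine ⟨fun h => ?_, fun h A hA => ?_⟩
  · ext A hA
    rw [Measure.map_apply measurable_neg hA, h A hA]
  · rw [← Measure.map_apply measurable_neg hA, h]

namespace IsSymmetricMeasure

lemma map (h : IsSymmetricMeasure ν) {g : EuclideanSpace ℝ (Fin d) → EuclideanSpace ℝ (Fin d')}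
    (hg : Measurable g) (hodd : g.Odd) : IsSymmetricMeasure (ν.map g) := by
  intro A hA
  rw [Measure.map_apply hg (measurable_neg hA), Measure.map_apply hg hA, ← h _ (hg hA)]
  congr 1
  ext s
  simp only [Set.mem_preimage, hodd s]

lemma withDensity (h : IsSymmetricMeasure ν) {f : EuclideanSpace ℝ (Fin d) → ENNReal}
    (hf : Measurable f) (heven : f.Even) : IsSymmetricMeasure (ν.withDensity f) := by
  intro A hA
  rw [withDensity_apply _ (measurable_neg hA), withDensity_apply _ hA]
  conv_rhs => rw [← isSymmetricMeasure_iff_map_neg_eq.1 h, setLIntegral_map hA hf measurable_neg]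
  simp only [heven _]

lemma sum {ι : Type*} {Γ : ι → Measure (EuclideanSpace ℝ (Fin d))}
    (h : ∀ i, IsSymmetricMeasure (Γ i)) : IsSymmetricMeasure (Measure.sum Γ) := by
  intro A hA
  rw [Measure.sum_apply _ (measurable_neg hA), Measure.sum_apply _ hA]
  exact tsum_congr fun i => h i A hA

end IsSymmetricMeasure

end SymmetricMeasure

section StableCharFun

variable {d d' : ℕ} {α : ℝ} {ν Γ Λ : Measure (EuclideanSpace ℝ (Fin d))}

lemma abs_inner_smul_left_rpow {E : Type*} [NormedAddCommGroup E] [InnerProductSpace ℝ E]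
    (α c : ℝ) (u s : E) : |inner ℝ (c • u) s| ^ α = |c| ^ α * |inner ℝ u s| ^ α := by
  rw [real_inner_smul_left, abs_mul, Real.mul_rpow (abs_nonneg _) (abs_nonneg _)]

namespace HasSymmetricStableCharFun

lemma integral_eq (hΓ : HasSymmetricStableCharFun α ν Γ) (hΛ : HasSymmetricStableCharFun α ν Λ)
    (u : EuclideanSpace ℝ (Fin d)) :
    ∫ s, |inner ℝ u s| ^ α ∂Γ = ∫ s, |inner ℝ u s| ^ α ∂Λ := by
  have hexp := (hΓ u).2.symm.trans (hΛ u).2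
  norm_cast at hexp
  exact neg_injective (Real.exp_injective hexp)

lemma charFun_smul (h : HasSymmetricStableCharFun α ν Γ) (c : ℝ)
    (u : EuclideanSpace ℝ (Fin d)) :
    charFun ν (c • u) =
      Complex.exp (-((|c| ^ α * ∫ s, |inner ℝ u s| ^ α ∂Γ : ℝ) : ℂ)) := by
  simp only [(h (c • u)).2, abs_inner_smul_left_rpow, integral_const_mul]

lemma map (h : HasSymmetricStableCharFun α ν Γ)
    (T : EuclideanSpace ℝ (Fin d) →L[ℝ] EuclideanSpace ℝ (Fin d')) :
    HasSymmetricStableCharFun α (ν.map T) (Γ.map T) := by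
  intro u
  have hadj : ∀ s, inner ℝ u (T s) = inner ℝ (ContinuousLinearMap.adjoint T u) s := fun s =>
    (ContinuousLinearMap.adjoint_inner_left T s u).symm
  have hmeas : AEStronglyMeasurable (fun s => |inner ℝ u s| ^ α) (Γ.map T) :=
    Measurable.aestronglyMeasurable (by fun_prop)
  have hcharFun : charFun (ν.map T) u = charFun ν (ContinuousLinearMap.adjoint T u) := by
    simp only [charFun_apply, real_inner_comm u, real_inner_comm (ContinuousLinearMap.adjoint T u)]
    rw [integral_map T.measurable.aemeasurable (by fun_prop)]
    simp only [hadj]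
  rw [integrable_map_measure hmeas T.measurable.aemeasurable,
    integral_map T.measurable.aemeasurable hmeas, hcharFun]
  simpa only [Function.comp_def, hadj] using h (ContinuousLinearMap.adjoint T u)

lemma isProbabilityMeasure (hα : α ≠ 0) (h : HasSymmetricStableCharFun α ν Γ) :
    IsProbabilityMeasure ν := by
  have hone : charFun ν 0 = 1 := by simpa [Real.zero_rpow hα] using (h 0).2
  rw [charFun_zero] at hone
  exact ⟨(ENNReal.toReal_eq_one_iff _).1 (by exact_mod_cast hone)⟩

lemma isAlphaStable (hα : α ≠ 0) (h : HasSymmetricStableCharFun α ν Γ) : IsAlphaStable α ν := by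
  have := h.isProbabilityMeasure hα
  refine ⟨this, fun A B hA hB => ⟨0, Measure.ext_of_charFun (funext fun u => ?_)⟩⟩
  have hsplit : (ν.prod ν).map (fun x => A • x.1 + B • x.2) =
      ((ν.map (A • ·)).prod (ν.map (B • ·))).map (fun x => x.1 + x.2) := by
    rw [Measure.map_prod_map _ _ (measurable_const_smul A) (measurable_const_smul B),
      Measure.map_map (by fun_prop) (by fun_prop)]
    rfl
  have hprob : ∀ c : ℝ, IsProbabilityMeasure (ν.map (c • ·)) := fun c =>
    Measure.isProbabilityMeasure_map (by fun_prop)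
  have hAB : 0 ≤ A ^ α + B ^ α := by positivity
  have hscale : |(A ^ α + B ^ α) ^ (1 / α)| ^ α = |A| ^ α + |B| ^ α := by
    rw [abs_of_nonneg (Real.rpow_nonneg hAB _), ← Real.rpow_mul hAB, one_div_mul_cancel hα,
      Real.rpow_one, abs_of_pos hA, abs_of_pos hB]
  simp only [add_zero]
  rw [hsplit, charFun_map_add_prod_eq_mul, Pi.mul_apply, charFun_map_smul, charFun_map_smul,
    charFun_map_smul, h.charFun_smul, h.charFun_smul, h.charFun_smul, ← Complex.exp_add, hscale]
  push_cast
  ring_nf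

lemma isSymmetricMeasure (hα : α ≠ 0) (h : HasSymmetricStableCharFun α ν Γ) :
    IsSymmetricMeasure ν := by
  have := h.isProbabilityMeasure hα
  refine isSymmetricMeasure_iff_map_neg_eq.2 (Measure.ext_of_charFun (funext fun u => ?_))
  have hneg := charFun_map_smul (μ := ν) (-1 : ℝ) u
  rw [h.charFun_smul, abs_neg, abs_one, Real.one_rpow, one_mul, ← (h u).2] at hneg
  simpa only [neg_one_smul] using hneg

lemma isSymmetricAlphaStable (hα : α ≠ 0) (h : HasSymmetricStableCharFun α ν Γ) :
    IsSymmetricAlphaStable α ν :=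
  ⟨h.isAlphaStable hα, h.isSymmetricMeasure hα⟩

end HasSymmetricStableCharFun

end StableCharFun

section Cylinder

/-- The kernel `{s | p s = 0}` of a seminorm, as a subspace: the directions that radial projection
does not send to the unit cylinder. -/
def seminormKernel {E : Type*} [AddCommGroup E] [Module ℝ E] (p : Seminorm ℝ E) :
    Submodule ℝ E where
  carrier := {s | p s = 0}
  add_mem' {x y} (hx : p x = 0) (hy : p y = 0) :=
    le_antisymm ((map_add_le_add p x y).trans_eq (by rw [hx, hy, add_zero])) (apply_nonneg p _)
  zero_mem' := map_zero p
  smul_mem' c x (hx : p x = 0) := show p (c • x) = 0 by rw [map_smul_eq_mul, hx, mul_zero]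

lemma mem_seminormKernel {E : Type*} [AddCommGroup E] [Module ℝ E] {p : Seminorm ℝ E} {s : E} :
    s ∈ seminormKernel p ↔ p s = 0 :=
  Iff.rfl

lemma continuous_seminorm_of_finiteDimensional {E : Type*} [NormedAddCommGroup E]
    [NormedSpace ℝ E] [FiniteDimensional ℝ E] (p : Seminorm ℝ E) : Continuous p :=
  continuousOn_univ.1 (p.convexOn.continuousOn isOpen_univ)

variable {d : ℕ} {α : ℝ} {ν Λ : Measure (EuclideanSpace ℝ (Fin d))}

lemma measurable_seminorm (p : Seminorm ℝ (EuclideanSpace ℝ (Fin d))) : Measurable p :=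
  (continuous_seminorm_of_finiteDimensional p).measurable

lemma measurable_seminorm_inv_smul (p : Seminorm ℝ (EuclideanSpace ℝ (Fin d))) :
    Measurable fun s => (p s)⁻¹ • s :=
  (measurable_seminorm p).inv.smul measurable_id

lemma measurable_ofReal_seminorm_rpow (α : ℝ) (p : Seminorm ℝ (EuclideanSpace ℝ (Fin d))) :
    Measurable fun s => ENNReal.ofReal (p s ^ α) :=
  ((measurable_seminorm p).pow_const α).ennreal_ofReal

/-- The image of `p(s) ^ α Λ(ds)` under the radial projection `s ↦ s / p(s)` onto the unit cylinder
of `p`. The weight preserves the integrals of `α`-homogeneous functions and, for `α ≠ 0`, discards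
the kernel of `p`, where the projection takes the junk value `0`. -/
noncomputable def cylindricalProjection (α : ℝ) (p : Seminorm ℝ (EuclideanSpace ℝ (Fin d)))
    (Λ : Measure (EuclideanSpace ℝ (Fin d))) : Measure (EuclideanSpace ℝ (Fin d)) :=
  (Λ.withDensity fun s => ENNReal.ofReal (p s ^ α)).map fun s => (p s)⁻¹ • s

lemma cylindricalProjection_compl_unitCylinder (hα : α ≠ 0)
    (p : Seminorm ℝ (EuclideanSpace ℝ (Fin d))) (Λ : Measure (EuclideanSpace ℝ (Fin d))) :
    cylindricalProjection α p Λ (unitCylinder p)ᶜ = 0 := by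
  have hcyl : MeasurableSet (unitCylinder p) := measurable_seminorm p (measurableSet_singleton 1)
  have hpre := measurable_seminorm_inv_smul p hcyl.compl
  rw [cylindricalProjection, Measure.map_apply (measurable_seminorm_inv_smul p) hcyl.compl,
    withDensity_apply _ hpre,
    setLIntegral_eq_zero_iff hpre (measurable_ofReal_seminorm_rpow α p)]
  refine ae_of_all _ fun s (hs : ¬ p ((p s)⁻¹ • s) = 1) => ?_
  have hps : p s = 0 := by
    by_contra hps
    rw [map_smul_eq_mul, Real.norm_of_nonneg (inv_nonneg.2 (apply_nonneg p s)),
      inv_mul_cancel₀ hps] at hs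
    exact hs rfl
  rw [hps, Real.zero_rpow hα, ENNReal.ofReal_zero]

lemma IsSymmetricMeasure.cylindricalProjection (h : IsSymmetricMeasure Λ) (α : ℝ)
    (p : Seminorm ℝ (EuclideanSpace ℝ (Fin d))) :
    IsSymmetricMeasure (cylindricalProjection α p Λ) :=
  (h.withDensity (measurable_ofReal_seminorm_rpow α p) fun s => by rw [map_neg_eq_map]).map
    (measurable_seminorm_inv_smul p) fun s => by rw [map_neg_eq_map, smul_neg]

lemma seminorm_rpow_mul_abs_inner_inv_smul_rpow {E : Type*} [NormedAddCommGroup E]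
    [InnerProductSpace ℝ E] (p : Seminorm ℝ E) {s : E} (hs : p s = 0 → s = 0) (u : E) (α : ℝ) :
    p s ^ α * |inner ℝ u ((p s)⁻¹ • s)| ^ α = |inner ℝ u s| ^ α := by
  rw [← Real.mul_rpow (apply_nonneg p s) (abs_nonneg _), real_inner_smul_right, abs_mul,
    abs_of_nonneg (inv_nonneg.2 (apply_nonneg p s))]
  rcases eq_or_ne (p s) 0 with hps | hps
  · rw [hs hps]
    simp
  · rw [mul_inv_cancel_left₀ hps]

lemma hasSymmetricStableCharFun_cylindricalProjection (h : HasSymmetricStableCharFun α ν Λ)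
    {p : Seminorm ℝ (EuclideanSpace ℝ (Fin d))} (hnull : Λ (seminormKernel p \ {0}) = 0) :
    HasSymmetricStableCharFun α ν (cylindricalProjection α p Λ) := by
  intro u
  have hproj := (measurable_seminorm_inv_smul p).aemeasurable
    (μ := Λ.withDensity fun s => ENNReal.ofReal (p s ^ α))
  have hdens := measurable_ofReal_seminorm_rpow α p
  have hfin : ∀ᵐ s ∂Λ, ENNReal.ofReal (p s ^ α) < ⊤ := ae_of_all _ fun s => ENNReal.ofReal_lt_top
  have hintegrand : (fun s => (ENNReal.ofReal (p s ^ α)).toReal •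
      |inner ℝ u ((p s)⁻¹ • s)| ^ α) =ᵐ[Λ] fun s => |inner ℝ u s| ^ α := by
    filter_upwards [measure_eq_zero_iff_ae_notMem.1 hnull] with s hs
    rw [ENNReal.toReal_ofReal (Real.rpow_nonneg (apply_nonneg p s) α), smul_eq_mul]
    exact seminorm_rpow_mul_abs_inner_inv_smul_rpow p
      (fun hps => by_contra fun hs0 => hs ⟨hps, hs0⟩) u α
  have hmeas : AEStronglyMeasurable (fun s => |inner ℝ u s| ^ α)
      (cylindricalProjection α p Λ) := Measurable.aestronglyMeasurable (by fun_prop)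
  rw [cylindricalProjection] at hmeas ⊢
  rw [integrable_map_measure hmeas hproj, integral_map hproj hmeas,
    integrable_withDensity_iff_integrable_smul' hdens hfin,
    integral_withDensity_eq_integral_toReal_smul hdens hfin, integral_congr_ae hintegrand]
  exact ⟨(h u).1.congr hintegrand.symm, (h u).2⟩

theorem HasSymmetricStableCharFun.isRepresentableOnCylinder_iff (hα₀ : 0 < α) (hα₂ : α < 2)
    (h : HasSymmetricStableCharFun α ν Λ) (hΛ : IsSymmetricMeasure Λ)
    (p : Seminorm ℝ (EuclideanSpace ℝ (Fin d))) :
    IsRepresentableOnCylinder α ν p ↔ Λ (seminormKernel p \ {0}) = 0 := by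
  constructor
  · rintro ⟨Γ, hcyl, -, hΓ⟩
    refine measure_submodule_diff_zero_eq_zero_of_forall_integral_eq hα₀ hα₂ (fun u => (h u).1)
      (fun u => (hΓ u).1) (h.integral_eq hΓ) _ (measure_mono_null ?_ hcyl)
    rintro s ⟨hs : p s = 0, -⟩ (hs' : p s = 1)
    exact zero_ne_one (hs.symm.trans hs')
  · exact fun hnull => ⟨cylindricalProjection α p Λ,
      cylindricalProjection_compl_unitCylinder hα₀.ne' p Λ, hΛ.cylindricalProjection α p,
      hasSymmetricStableCharFun_cylindricalProjection h hnull⟩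

end Cylinder

section IndependentSums

variable {ι κ : Type*} {l : Filter κ}

lemma summable_of_tendsto_prod_exp_neg [l.NeBot] {a : ι → ℝ} (ha : ∀ i, 0 ≤ a i)
    {J : κ → Finset ι} (hJ : Tendsto J l atTop) {z : ℂ} (hz : z ≠ 0)
    (h : Tendsto (fun n => ∏ i ∈ J n, Complex.exp (-(a i : ℂ))) l (𝓝 z)) : Summable a := by
  have hsums : Tendsto (fun n => ∑ i ∈ J n, a i) l (𝓝 (-Real.log ‖z‖)) := by
    refine (h.norm.log (norm_ne_zero_iff.2 hz)).neg.congr fun n => ?_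
    simp [← Complex.exp_sum, Complex.norm_exp]
  refine summable_of_sum_le ha fun s => ge_of_tendsto hsums ?_
  filter_upwards [hJ.eventually (eventually_ge_atTop s)] with n hn
  exact Finset.sum_le_sum_of_subset_of_nonneg hn fun i _ _ => ha i

lemma exists_ne_zero_charFun_smul_ne_zero {E : Type*} [NormedAddCommGroup E]
    [InnerProductSpace ℝ E] [MeasurableSpace E] [BorelSpace E] [SecondCountableTopology E]
    (ν : Measure E) [IsProbabilityMeasure ν] (u : E) : ∃ c : ℝ, c ≠ 0 ∧ charFun ν (c • u) ≠ 0 := by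
  have hcont : Continuous fun c : ℝ => charFun ν (c • u) :=
    continuous_charFun.comp (continuous_id.smul continuous_const)
  have hnear : ∀ᶠ c : ℝ in 𝓝[≠] 0, charFun ν (c • u) ≠ 0 :=
    (hcont.tendsto 0).mono_left nhdsWithin_le_nhds |>.eventually_ne (by simp)
  exact (eventually_mem_nhdsWithin.and hnear).exists

variable {d : ℕ} {α : ℝ} {ν : Measure (EuclideanSpace ℝ (Fin d))}
  {μ Γ : ι → Measure (EuclideanSpace ℝ (Fin d))}

-- `charFun ν` may vanish at `u`, but not along the whole line `ℝ • u`, on which the exponents are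
-- proportional to each other.
lemma summable_integral_of_tendsto_prod_charFun [l.NeBot] [IsProbabilityMeasure ν]
    (h : ∀ i, HasSymmetricStableCharFun α (μ i) (Γ i)) {J : κ → Finset ι} (hJ : Tendsto J l atTop)
    (hlim : ∀ u, Tendsto (fun n => ∏ i ∈ J n, charFun (μ i) u) l (𝓝 (charFun ν u)))
    (u : EuclideanSpace ℝ (Fin d)) : Summable fun i => ∫ s, |inner ℝ u s| ^ α ∂Γ i := by
  obtain ⟨c, hc, hcu⟩ := exists_ne_zero_charFun_smul_ne_zero ν u
  have hprod := hlim (c • u)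
  simp only [(h _).charFun_smul] at hprod
  exact (summable_mul_left_iff (Real.rpow_pos_of_pos (abs_pos.2 hc) α).ne').1
    (summable_of_tendsto_prod_exp_neg (fun i => by positivity) hJ hcu hprod)

lemma hasSymmetricStableCharFun_sum_of_tendsto_prod_charFun [Countable ι] [l.NeBot]
    [IsProbabilityMeasure ν] (h : ∀ i, HasSymmetricStableCharFun α (μ i) (Γ i))
    {J : κ → Finset ι} (hJ : Tendsto J l atTop)
    (hlim : ∀ u, Tendsto (fun n => ∏ i ∈ J n, charFun (μ i) u) l (𝓝 (charFun ν u))) :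
    HasSymmetricStableCharFun α ν (Measure.sum Γ) := by
  intro u
  have hint : Integrable (fun s => |inner ℝ u s| ^ α) (Measure.sum Γ) := by
    refine integrable_sum_measure (fun i => (h i u).1) ?_
    simpa only [Real.norm_of_nonneg (Real.rpow_nonneg (abs_nonneg _) α)] using
      summable_integral_of_tendsto_prod_charFun h hJ hlim u
  refine ⟨hint, tendsto_nhds_unique (hlim u) ?_⟩
  have hsums := (hasSum_integral_measure hint).comp hJ
  refine ((Complex.continuous_exp.comp Complex.continuous_ofReal.neg).tendsto _ |>.comp hsums).congr
    fun n => ?_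
  simp [(h _ u).2, ← Complex.exp_sum]

theorem hasSymmetricStableCharFun_sum_of_tendstoInDistribution [Countable ι]
    {Ω Ω' : Type*} [MeasurableSpace Ω] [MeasurableSpace Ω'] {P : Measure Ω} {Q : Measure Ω'}
    [IsProbabilityMeasure P] [IsProbabilityMeasure Q] {Y : ι → Ω → EuclideanSpace ℝ (Fin d)}
    {Z : Ω' → EuclideanSpace ℝ (Fin d)} (hY : ∀ i, AEMeasurable (Y i) P) (hindep : iIndepFun Y P)
    (h : ∀ i, HasSymmetricStableCharFun α (P.map (Y i)) (Γ i)) {J : ℕ → Finset ι}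
    (hJ : Tendsto J atTop atTop)
    (hlim : TendstoInDistribution (fun n ω => ∑ i ∈ J n, Y i ω) atTop Z (fun _ => P) Q) :
    HasSymmetricStableCharFun α (Q.map Z) (Measure.sum Γ) := by
  have := Measure.isProbabilityMeasure_map (μ := Q) hlim.aemeasurable_limit
  refine hasSymmetricStableCharFun_sum_of_tendsto_prod_charFun h hJ fun u => ?_
  refine (ProbabilityMeasure.tendsto_iff_tendsto_charFun.1 hlim.tendsto u).congr fun n => ?_
  rw [ProbabilityMeasure.coe_mk,
    (hindep.restrict _).charFun_map_fun_finsetSum_eq_prod fun i _ => hY i, Finset.prod_apply]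

end IndependentSums

lemma tendstoInMeasure_comp_of_identDistrib {Ω Ω' E F : Type*} [MeasurableSpace Ω]
    [MeasurableSpace Ω'] [MeasurableSpace E] [PseudoEMetricSpace F] [MeasurableSpace F]
    [BorelSpace F] [SecondCountableTopology F] {P : Measure Ω} {Q : Measure Ω'} [IsFiniteMeasure Q]
    {Z : ℕ → Ω → E} {Y : Ω' → E} (hZ : ∀ n, IdentDistrib (Z n) Y P Q) {g : ℕ → E → F}
    (hg : ∀ n, Measurable (g n)) {c : F} (hlim : ∀ x, Tendsto (fun n => g n x) atTop (𝓝 c)) :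
    TendstoInMeasure P (fun n ω => g n (Z n ω)) atTop fun _ => c := by
  have hY : TendstoInMeasure Q (fun n ω => g n (Y ω)) atTop fun _ => c :=
    tendstoInMeasure_of_tendsto_ae
      (fun n => ((hg n).comp_aemeasurable (hZ n).aemeasurable_snd).aestronglyMeasurable)
      (ae_of_all _ fun ω => hlim (Y ω))
  intro δ hδ
  refine (hY δ hδ).congr fun n => ?_
  exact ((hZ n).comp (hg n)).measure_mem_eq
    (measurableSet_le measurable_const (measurable_id.edist measurable_const)) |>.symm

section AutoregressiveWeights

/-- The impulse response `j ↦ ρ ^ j 𝟙{0 ≤ j}` of a first-order autoregression, as a sequence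
indexed by `ℤ`. -/
noncomputable def arWeight (ρ : ℝ) (j : ℤ) : ℝ :=
  if 0 ≤ j then ρ ^ j.toNat else 0

variable {ρ : ℝ} {j : ℤ}

lemma arWeight_of_neg (ρ : ℝ) (hj : j < 0) : arWeight ρ j = 0 :=
  if_neg hj.not_ge

@[simp]
lemma arWeight_zero (ρ : ℝ) : arWeight ρ 0 = 1 := by
  simp [arWeight]

lemma arWeight_add_one (ρ : ℝ) (hj : 0 ≤ j) : arWeight ρ (j + 1) = arWeight ρ j * ρ := by
  rw [arWeight, arWeight, if_pos hj, if_pos (by lia), Int.toNat_add hj zero_le_one, Int.toNat_one,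
    pow_succ]

lemma arWeight_ne_zero (hρ : ρ ≠ 0) (hj : 0 ≤ j) : arWeight ρ j ≠ 0 := by
  rw [arWeight, if_pos hj]
  exact pow_ne_zero _ hρ

lemma tendsto_arWeight_cofinite (hρ : |ρ| < 1) : Tendsto (arWeight ρ) cofinite (𝓝 0) := by
  rw [Int.cofinite_eq, tendsto_sup]
  constructor
  · refine tendsto_const_nhds.congr' ?_
    filter_upwards [eventually_lt_atBot 0] with j hj
    exact (arWeight_of_neg ρ hj).symm
  · have htoNat : Tendsto Int.toNat atTop atTop :=
      tendsto_natCast_atTop_iff.1 (tendsto_atTop_mono Int.self_le_toNat tendsto_id)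
    have hpow := (tendsto_pow_atTop_nhds_zero_of_abs_lt_one hρ).comp htoNat
    refine hpow.congr' ?_
    filter_upwards [eventually_ge_atTop 0] with j hj
    exact (if_pos hj).symm

variable {x e : ℤ → ℝ} {k l m : ℤ}

lemma eq_sum_arWeight_of_anticipative (h : ∀ s, x s = ρ * x (s + 1) + e s) (hlk : l ≤ k)
    (hkm : k ≤ m + 1) :
    x k = ∑ j ∈ Finset.Icc l m, arWeight ρ (j - k) * e j + arWeight ρ (m + 1 - k) * x (m + 1) := by
  obtain ⟨m, rfl⟩ : ∃ m', m = m' - 1 := ⟨m + 1, by ring⟩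
  rw [sub_add_cancel] at hkm ⊢
  induction m, hkm using Int.leInduction with
  | base =>
    rw [Finset.sum_eq_zero fun j hj => ?_, sub_self, arWeight_zero, zero_add, one_mul]
    rw [arWeight_of_neg ρ (by grind), zero_mul]
  | succ m hkm ih =>
    have hIcc : Finset.Icc l (m + 1 - 1) = insert m (Finset.Icc l (m - 1)) := by grind
    rw [ih, hIcc, Finset.sum_insert (by simp), h m, add_sub_right_comm m 1 k,
      arWeight_add_one ρ (sub_nonneg.2 hkm)]
    ring

lemma eq_sum_arWeight_of_causal (h : ∀ s, x s = ρ * x (s - 1) + e s) (hlk : l - 1 ≤ k)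
    (hkm : k ≤ m) :
    x k = ∑ j ∈ Finset.Icc l m, arWeight ρ (k - j) * e j +
      arWeight ρ (k - (l - 1)) * x (l - 1) := by
  have hreversed := eq_sum_arWeight_of_anticipative (x := fun s => x (-s)) (e := fun s => e (-s))
    (l := -m) (k := -k) (m := -l) (fun s => by rw [h (-s), neg_add']) (by lia) (by lia)
  have hreindex : ∑ j ∈ Finset.Icc (-m) (-l), arWeight ρ (j - -k) * e (-j) =
      ∑ j ∈ Finset.Icc l m, arWeight ρ (k - j) * e j :=
    Finset.sum_equiv (Equiv.neg ℤ) (by simp; grind) fun j _ => by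
      rw [Equiv.neg_apply, sub_neg_eq_add, sub_neg_eq_add, add_comm]
  rwa [hreindex, neg_neg, neg_add', neg_neg, show -l + 1 - -k = k - (l - 1) by ring] at hreversed

end AutoregressiveWeights

section StackedVector

variable {ρ₁ ρ₂ : ℝ} {j : ℤ} {Γ : Measure (EuclideanSpace ℝ (Fin 2))}

/-- The linear map by which the error at time `t + j` enters the stacked vector at time `t`. -/
noncomputable def arFilter (ρ₁ ρ₂ : ℝ) (j : ℤ) :
    EuclideanSpace ℝ (Fin 2) →L[ℝ] EuclideanSpace ℝ (Fin 4) :=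
  (Matrix.toLpLin 2 2 !![arWeight ρ₁ j, 0; 0, arWeight ρ₂ (-j); arWeight ρ₁ (j - 1), 0;
    0, arWeight ρ₂ (1 - j)]).toContinuousLinearMap

lemma arFilter_apply (ρ₁ ρ₂ : ℝ) (j : ℤ) (s : EuclideanSpace ℝ (Fin 2)) :
    arFilter ρ₁ ρ₂ j s = !₂[arWeight ρ₁ j * s 0, arWeight ρ₂ (-j) * s 1,
      arWeight ρ₁ (j - 1) * s 0, arWeight ρ₂ (1 - j) * s 1] := by
  ext i
  fin_cases i <;> simp [arFilter, Matrix.toLpLin_apply, dotProduct]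

lemma tendsto_arFilter_apply_cofinite (hρ₁ : |ρ₁| < 1) (hρ₂ : |ρ₂| < 1)
    (s : EuclideanSpace ℝ (Fin 2)) :
    Tendsto (fun j => arFilter ρ₁ ρ₂ j s) cofinite (𝓝 0) := by
  have hweight : ∀ {ρ : ℝ} {φ : ℤ → ℤ} (c : ℝ), |ρ| < 1 → φ.Injective →
      Tendsto (fun j => arWeight ρ (φ j) * c) cofinite (𝓝 0) := fun c hρ hφ => by
    simpa using ((tendsto_arWeight_cofinite hρ).comp hφ.tendsto_cofinite).mul_const c
  simp only [arFilter_apply]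
  refine (PiLp.continuous_toLp 2 _).tendsto' 0 0 rfl |>.comp (tendsto_pi_nhds.2 fun i => ?_)
  fin_cases i
  exacts [hweight _ hρ₁ Function.injective_id, hweight _ hρ₂ neg_injective,
    hweight _ hρ₁ sub_left_injective, hweight _ hρ₂ sub_right_injective]

lemma stackedVector_eq_sum_arFilter_add {Ω : Type*} {ε X : ℤ → Ω → EuclideanSpace ℝ (Fin 2)}
    {ω : Ω} (hanticipative : ∀ s, X s ω 0 = ρ₁ * X (s + 1) ω 0 + ε s ω 0)
    (hcausal : ∀ s, X s ω 1 = ρ₂ * X (s - 1) ω 1 + ε s ω 1) (t : ℤ) {l m : ℤ} (hl : l ≤ 0)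
    (hm : 1 ≤ m) :
    stackedVector X t ω = ∑ j ∈ Finset.Icc l m, arFilter ρ₁ ρ₂ j (ε (t + j) ω) +
      (arFilter ρ₁ ρ₂ (m + 1) (X (t + (m + 1)) ω) +
        arFilter ρ₁ ρ₂ (l - 1) (X (t + (l - 1)) ω)) := by
  have hanticipative' : ∀ j, X (t + j) ω 0 = ρ₁ * X (t + (j + 1)) ω 0 + ε (t + j) ω 0 :=
    fun j => by rw [hanticipative (t + j), add_assoc]
  have hcausal' : ∀ j, X (t + j) ω 1 = ρ₂ * X (t + (j - 1)) ω 1 + ε (t + j) ω 1 :=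
    fun j => by rw [hcausal (t + j), add_sub_assoc]
  have h₁₀ := eq_sum_arWeight_of_anticipative (k := 0) (m := m) hanticipative' hl (by lia)
  have h₁₁ := eq_sum_arWeight_of_anticipative (k := 1) (l := l) (m := m) hanticipative' (by lia)
    (by lia)
  have h₂₀ := eq_sum_arWeight_of_causal (k := 0) (l := l) (m := m) hcausal' (by lia) (by lia)
  have h₂₁ := eq_sum_arWeight_of_causal (k := 1) (l := l) hcausal' (by lia) hm
  ext i
  fin_cases i
  · simpa [stackedVector, arFilter_apply, arWeight_of_neg ρ₁ (by lia : l - 1 < 0)] using h₁₀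
  · simpa [stackedVector, arFilter_apply, arWeight_of_neg ρ₂ (by lia : -1 + -m < 0)] using h₂₀
  · simpa [stackedVector, arFilter_apply, arWeight_of_neg ρ₁ (by lia : l - 1 - 1 < 0)] using h₁₁
  · simpa [stackedVector, arFilter_apply, arWeight_of_neg ρ₂ (by lia : -m < 0)] using h₂₁

lemma measurable_stackedVector {Ω : Type*} [MeasurableSpace Ω]
    {X : ℤ → Ω → EuclideanSpace ℝ (Fin 2)} (hX : ∀ t, Measurable (X t)) (t : ℤ) :
    Measurable (stackedVector X t) := by
  have hcoord : ∀ s i, Measurable fun ω => X s ω i := fun s i => by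
    have := hX s
    fun_prop
  refine (WithLp.measurable_toLp 2 _).comp (measurable_pi_iff.2 fun i => ?_)
  fin_cases i
  exacts [hcoord t 0, hcoord t 1, hcoord (t + 1) 0, hcoord (t + 1) 1]

lemma presentSeminorm_eq_zero_iff {x : EuclideanSpace ℝ (Fin 4)} :
    presentSeminorm x = 0 ↔ x 0 = 0 ∧ x 1 = 0 := by
  change √(x 0 ^ 2 + x 1 ^ 2) = 0 ↔ _
  rw [Real.sqrt_eq_zero (by positivity),
    add_eq_zero_iff_of_nonneg (sq_nonneg _) (sq_nonneg _), sq_eq_zero_iff, sq_eq_zero_iff]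

lemma arFilter_mem_seminormKernel_iff (hρ₁ : ρ₁ ≠ 0) {s : EuclideanSpace ℝ (Fin 2)} :
    arFilter ρ₁ ρ₂ j s ∈ (seminormKernel presentSeminorm : Set _) \ {0} ↔
      j = 1 ∧ s 0 = 0 ∧ s 1 ≠ 0 := by
  have hkernel : arFilter ρ₁ ρ₂ j s ∈ seminormKernel presentSeminorm ↔
      arWeight ρ₁ j * s 0 = 0 ∧ arWeight ρ₂ (-j) * s 1 = 0 := by
    rw [mem_seminormKernel, presentSeminorm_eq_zero_iff, arFilter_apply]
    rfl
  have hzero : arFilter ρ₁ ρ₂ j s = 0 ↔ arWeight ρ₁ j * s 0 = 0 ∧ arWeight ρ₂ (-j) * s 1 = 0 ∧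
      arWeight ρ₁ (j - 1) * s 0 = 0 ∧ arWeight ρ₂ (1 - j) * s 1 = 0 := by
    rw [arFilter_apply, ← WithLp.ofLp_eq_zero 2]
    simp
  rw [Set.mem_sdiff, SetLike.mem_coe, Set.mem_singleton_iff, hkernel, hzero]
  rcases le_or_gt j 0 with hj | hj
  · have hw₁ : arWeight ρ₁ (j - 1) = 0 := arWeight_of_neg ρ₁ (by lia)
    have hw₂ : arWeight ρ₂ (1 - j) = arWeight ρ₂ (-j) * ρ₂ := by
      rw [← arWeight_add_one ρ₂ (neg_nonneg.2 hj), neg_add_eq_sub]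
    grind
  · have hw₁ : arWeight ρ₁ j ≠ 0 := arWeight_ne_zero hρ₁ hj.le
    have hw₂ : arWeight ρ₂ (-j) = 0 := arWeight_of_neg ρ₂ (neg_lt_zero.2 hj)
    rcases eq_or_ne j 1 with rfl | hj₁
    · grind [arWeight_zero]
    · have hw₂' : arWeight ρ₂ (1 - j) = 0 := arWeight_of_neg ρ₂ (by lia)
      grind

/-- The spectral measure of the stacked vector, carried by `ℝ⁴` and not normalised to a sphere:
a superposition of the images of the spectral measure `Γ` of the errors. -/
noncomputable def stackedSpectralMeasure (ρ₁ ρ₂ : ℝ) (Γ : Measure (EuclideanSpace ℝ (Fin 2))) :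
    Measure (EuclideanSpace ℝ (Fin 4)) :=
  Measure.sum fun j => Γ.map (arFilter ρ₁ ρ₂ j)

lemma IsSymmetricMeasure.stackedSpectralMeasure (h : IsSymmetricMeasure Γ) (ρ₁ ρ₂ : ℝ) :
    IsSymmetricMeasure (stackedSpectralMeasure ρ₁ ρ₂ Γ) :=
  IsSymmetricMeasure.sum fun j => h.map (arFilter ρ₁ ρ₂ j).measurable (map_neg _)

lemma stackedSpectralMeasure_seminormKernel_diff_zero (hρ₁ : ρ₁ ≠ 0) (ρ₂ : ℝ)
    (Γ : Measure (EuclideanSpace ℝ (Fin 2))) :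
    stackedSpectralMeasure ρ₁ ρ₂ Γ (seminormKernel presentSeminorm \ {0}) =
      Γ {s | s 0 = 0 ∧ s 1 ≠ 0} := by
  have hmeas : MeasurableSet
      ((seminormKernel presentSeminorm : Set (EuclideanSpace ℝ (Fin 4))) \ {0}) :=
    ((measurableSet_singleton 0).preimage (measurable_seminorm presentSeminorm)).diff
      (measurableSet_singleton 0)
  rw [stackedSpectralMeasure, Measure.sum_apply _ hmeas]
  simp only [Measure.map_apply (arFilter ρ₁ ρ₂ _).measurable hmeas, Set.preimage,
    arFilter_mem_seminormKernel_iff hρ₁]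
  rw [tsum_eq_single 1 fun j hj => by simp [hj]]
  simp

lemma measure_axis_diff_zero_eq_of_sphere (hΓ : Γ (Metric.sphere 0 1)ᶜ = 0) :
    Γ {s | s 0 = 0 ∧ s 1 ≠ 0} = Γ {!₂[(0 : ℝ), -1], !₂[(0 : ℝ), 1]} := by
  have hvec : ∀ (s : EuclideanSpace ℝ (Fin 2)) (c : ℝ), s = !₂[0, c] ↔ s 0 = 0 ∧ s 1 = c :=
    fun s c => by rw [PiLp.ext_iff, Fin.forall_fin_two]; rfl
  refine measure_congr (Eventually.set_eq ?_)
  filter_upwards [measure_eq_zero_iff_ae_notMem.1 hΓ] with s hs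
  rw [Set.notMem_compl_iff, mem_sphere_zero_iff_norm, EuclideanSpace.norm_eq, Real.sqrt_eq_one,
    Fin.sum_univ_two, Real.norm_eq_abs, Real.norm_eq_abs, sq_abs, sq_abs] at hs
  rw [Set.mem_insert_iff, Set.mem_singleton_iff, hvec, hvec]
  grind

end StackedVector

section AutoregressiveProcess

lemma IsStrictlyStationary.identDistrib {Ω E : Type*} [MeasurableSpace Ω] [MeasurableSpace E]
    {P : Measure Ω} {X : ℤ → Ω → E} (h : IsStrictlyStationary P X) (s : ℤ) :
    IdentDistrib (X s) (X 0) P P := by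
  simpa [Function.comp_def] using (h s).comp (measurable_pi_apply 0)

namespace IsBivariateStableAR1

variable {Ω : Type*} [MeasurableSpace Ω] {P : Measure Ω} [IsProbabilityMeasure P] {α ρ₁ ρ₂ : ℝ}
  {Γ : Measure (EuclideanSpace ℝ (Fin 2))} {ε X : ℤ → Ω → EuclideanSpace ℝ (Fin 2)}

lemma tendstoInMeasure_neg_arFilter (hX : IsBivariateStableAR1 P α ρ₁ ρ₂ Γ ε X) (hρ₁ : |ρ₁| < 1)
    (hρ₂ : |ρ₂| < 1) (t : ℤ) {φ : ℕ → ℤ} (hφ : φ.Injective) :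
    TendstoInMeasure P (fun n ω => -arFilter ρ₁ ρ₂ (φ n) (X (t + φ n) ω)) atTop fun _ => 0 :=
  tendstoInMeasure_comp_of_identDistrib (fun n => hX.stationary.identDistrib (t + φ n))
    (fun n => (arFilter ρ₁ ρ₂ (φ n)).measurable.neg) fun s => by
      simpa [Nat.cofinite_eq_atTop, Function.comp_def] using
        ((tendsto_arFilter_apply_cofinite hρ₁ hρ₂ s).comp hφ.tendsto_cofinite).neg

lemma tendstoInDistribution_sum_arFilter (hX : IsBivariateStableAR1 P α ρ₁ ρ₂ Γ ε X)
    (hρ₁ : |ρ₁| < 1) (hρ₂ : |ρ₂| < 1) (t : ℤ) :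
    TendstoInDistribution
      (fun (n : ℕ) ω => ∑ j ∈ Finset.Icc (-((n + 1 : ℕ) : ℤ)) ((n + 1 : ℕ) : ℤ),
        arFilter ρ₁ ρ₂ j (ε (t + j) ω)) atTop (stackedVector X t) (fun _ => P) P := by
  have hmeas : ∀ j, AEMeasurable (fun ω => -arFilter ρ₁ ρ₂ j (X (t + j) ω)) P := fun j =>
    ((arFilter ρ₁ ρ₂ j).measurable.comp (hX.measurable (t + j))).neg.aemeasurable
  have hright := hX.tendstoInMeasure_neg_arFilter hρ₁ hρ₂ t (φ := fun n => ((n + 1 : ℕ) : ℤ) + 1)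
    fun a b hab => by grind
  have hleft := hX.tendstoInMeasure_neg_arFilter hρ₁ hρ₂ t (φ := fun n => -((n + 1 : ℕ) : ℤ) - 1)
    fun a b hab => by grind
  have hconst := tendstoInDistribution_const (l := atTop (α := ℕ))
    (measurable_stackedVector hX.measurable t).aemeasurable (μ' := P)
  have hadd := (hconst.add_of_tendstoInMeasure_const hright fun n =>
    hmeas _).add_of_tendstoInMeasure_const hleft fun n => hmeas _
  refine hadd.congr (fun n => ?_) (ae_of_all _ fun ω => by simp)
  filter_upwards [ae_all_iff.2 hX.anticipative, ae_all_iff.2 hX.causal] with ω h₁ h₂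
  simp only [Pi.add_apply]
  rw [stackedVector_eq_sum_arFilter_add h₁ h₂ t (l := -((n + 1 : ℕ) : ℤ))
    (m := ((n + 1 : ℕ) : ℤ)) (by lia) (by lia)]
  abel

theorem hasSymmetricStableCharFun (hX : IsBivariateStableAR1 P α ρ₁ ρ₂ Γ ε X) (hρ₁ : |ρ₁| < 1)
    (hρ₂ : |ρ₂| < 1) (t : ℤ) :
    HasSymmetricStableCharFun α (P.map (stackedVector X t)) (stackedSpectralMeasure ρ₁ ρ₂ Γ) := by
  have hT : ∀ j, Measurable (arFilter ρ₁ ρ₂ j) := fun j => (arFilter ρ₁ ρ₂ j).measurable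
  refine hasSymmetricStableCharFun_sum_of_tendstoInDistribution
    (fun j => ((hT j).comp (hX.measurable_error (t + j))).aemeasurable)
    ((hX.indep_error.precomp (add_right_injective t)).comp _ hT) (fun j => ?_)
    (Finset.tendsto_Icc_neg.comp (tendsto_add_atTop_nat 1))
    (hX.tendstoInDistribution_sum_arFilter hρ₁ hρ₂ t)
  rw [← Measure.map_map (hT j) (hX.measurable_error _)]
  exact (hX.law_error (t + j)).charFun_eq.map _

end IsBivariateStableAR1

end AutoregressiveProcess

theorem proposition8 {Ω : Type*} [MeasurableSpace Ω] (P : Measure Ω) [IsProbabilityMeasure P]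
    (α ρ₁ ρ₂ : ℝ) (hα₀ : 0 < α) (hα₂ : α < 2)
    (hρ₁ : 0 < |ρ₁|) (hρ₁' : |ρ₁| < 1) (hρ₂ : 0 < |ρ₂|) (hρ₂' : |ρ₂| < 1)
    (Γ₂ : Measure (EuclideanSpace ℝ (Fin 2)))
    (ε X : ℤ → Ω → EuclideanSpace ℝ (Fin 2))
    (hX : IsBivariateStableAR1 P α ρ₁ ρ₂ Γ₂ ε X) (t : ℤ) :
    IsSymmetricAlphaStable α (P.map (stackedVector X t)) ∧
      (IsRepresentableOnCylinder α (P.map (stackedVector X t)) presentSeminorm ↔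
        Γ₂ {!₂[(0 : ℝ), -1], !₂[(0 : ℝ), 1]} = 0) := by
  have hchar := hX.hasSymmetricStableCharFun hρ₁' hρ₂' t
  have hsymm := (hX.law_error 0).symmetric.stackedSpectralMeasure ρ₁ ρ₂
  refine ⟨hchar.isSymmetricAlphaStable hα₀.ne', ?_⟩
  rw [hchar.isRepresentableOnCylinder_iff hα₀ hα₂ hsymm presentSeminorm,
    stackedSpectralMeasure_seminormKernel_diff_zero (abs_pos.1 hρ₁) ρ₂ Γ₂,
    measure_axis_diff_zero_eq_of_sphere (hX.law_error 0).on_sphere]
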